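/- Definition. Let $\{P_\theta:\theta\in\Omega\}$ be a family of probability distributions, let $K\ge 2$, and let $T$ be a deterministic function of $K$ variables. The family is *thinned by $T$* if there are distributions $G_t$ (a Markov kernel $t\mapsto G_t$), not depending on $\theta$, such that for every $\theta\in\Omega$, when $X\sim P_\theta$ is drawn and then $(X^{(1)},\dots,X^{(K)})$ is drawn from $G_X$ conditionally on $X$, 1. $X^{(1)},\dots,X^{(K)}$ are mutually independent, and 2. $X=T(X^{(1)},\dots,X^{(K)})$ almost surely, and moreover, for each $k$, the distribution of $X^{(k)}$ depends on $\theta$ (it is not the same for all $\theta\in\Omega$). Corollary. The Bernoulli family $\{\mathrm{Bernoulli}(\theta):\theta\in(0,1)\}$, where $\theta$ is the probability of success, cannot be thinned by any function $T$: for every $K\ge 2$, all measurable spaces $\mathcal X_1,\dots,\mathcal X_K$ in which $X^{(1)},\dots,X^{(K)}$ may take their values, and every function $T:\mathcal X_1\times\dots\times\mathcal X_K\to\mathbb R$ (measurable or not), the Bernoulli family is not thinned by $T$. -/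

import Mathlib

open MeasureTheory ProbabilityTheory

/-- The Bernoulli family on the real line, indexed by the probability of success `θ ∈ (0, 1)`:
under `bernoulliFamily θ`, the value `1` has probability `θ` and the value `0` has
probability `1 - θ`. -/
noncomputable def bernoulliFamily (θ : Set.Ioo (0 : ℝ) 1) : Measure ℝ :=
  bernoulliMeasure 1 0 ⟨θ.1, θ.2.1.le, θ.2.2.le⟩

instance (θ : Set.Ioo (0 : ℝ) 1) : IsProbabilityMeasure (bernoulliFamily θ) := by
  unfold bernoulliFamily; infer_instance

/-- The family `P` of probability distributions, indexed by `θ : Θ`, is thinned by the deterministic function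
`T` into `K` random variables with values in the measurable spaces `𝓧 0, …, 𝓧 (K - 1)`.

There is a Markov kernel `G`, which does not depend on `θ`, such that the following holds when `X`
is drawn from `P θ` and then, given `X`, the tuple `(X⁽¹⁾, …, X⁽ᴷ⁾)` is drawn from `G X`. The joint
law of `(X, (X⁽¹⁾, …, X⁽ᴷ⁾))` is then `P θ ⊗ₘ G`, and the law of the `k`-th component is the image
of `P θ ⊗ₘ G` under `p ↦ p.2 k`.

The function `T` is arbitrary; in particular it is not required to be measurable. -/
def IsThinnedBy {Θ 𝓨 : Type*} [MeasurableSpace 𝓨] (P : Θ → Measure 𝓨)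
    [∀ θ, IsProbabilityMeasure (P θ)] {K : ℕ} {𝓧 : Fin K → Type*} [∀ k, MeasurableSpace (𝓧 k)]
    (T : (∀ k, 𝓧 k) → 𝓨) : Prop :=
  ∃ G : Kernel 𝓨 (∀ k, 𝓧 k), IsMarkovKernel G ∧
    -- the components are mutually independent under every `θ`
    (∀ θ, iIndepFun (fun k (p : 𝓨 × (∀ k, 𝓧 k)) => p.2 k) (P θ ⊗ₘ G)) ∧
    -- the distribution of each component depends on `θ`
    (∀ k, ∃ θ₁ θ₂, (P θ₁ ⊗ₘ G).map (fun p => p.2 k) ≠ (P θ₂ ⊗ₘ G).map (fun p => p.2 k)) ∧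
    -- the components reconstruct `X` through `T`
    (∀ θ, ∀ᵐ p ∂(P θ ⊗ₘ G), p.1 = T p.2)

/-! Every event of the tuple has probability affine in `θ`. Independence of two components equates
an affine function with a product of two, so the product of the slopes vanishes
(`mul_sub_eq_zero_of_mixture_mul`). Yet each component has an event of nonzero slope
(`exists_real_ne_of_map_ne`). -/

/-- Under the joint law `bernoulliFamily θ ⊗ₘ G`, the second component is distributed as the mixture
of `G 1` and `G 0` with weights `θ` and `1 - θ`. -/
theorem real_bernoulliFamily_compProd_snd_preimage {E : Type*} [MeasurableSpace E]
    (G : Kernel ℝ E) [IsMarkovKernel G] (θ : Set.Ioo (0 : ℝ) 1) {s : Set E}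
    (hs : MeasurableSet s) :
    (bernoulliFamily θ ⊗ₘ G).real (Prod.snd ⁻¹' s) =
      θ.1 * (G 1).real s + (1 - θ.1) * (G 0).real s := by
  have hpre (x : ℝ) : Prod.mk x ⁻¹' (Prod.snd ⁻¹' s) = s := rfl
  rw [Measure.real, Measure.compProd_apply (measurable_snd hs), bernoulliFamily,
    bernoulliMeasure_def, lintegral_add_measure, lintegral_smul_measure, lintegral_smul_measure,
    lintegral_dirac, lintegral_dirac]
  simp only [hpre, ENNReal.smul_def, smul_eq_mul]
  rw [ENNReal.toReal_add (by finiteness) (by finiteness)]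
  simp [Measure.real]

/-- If every mixture `θ • G 1 + (1 - θ) • G 0` makes two events independent, then one of the two
events has the same probability under `G 0` and `G 1`: the coefficient of `θ ^ 2` vanishes. -/
theorem mul_sub_eq_zero_of_mixture_mul {a₀ a₁ b₀ b₁ c₀ c₁ : ℝ}
    (h : ∀ θ : Set.Ioo (0 : ℝ) 1, θ.1 * c₁ + (1 - θ.1) * c₀ =
      (θ.1 * a₁ + (1 - θ.1) * a₀) * (θ.1 * b₁ + (1 - θ.1) * b₀)) :
    (a₁ - a₀) * (b₁ - b₀) = 0 := by
  have h₁ := h ⟨1 / 4, by norm_num, by norm_num⟩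
  have h₂ := h ⟨1 / 2, by norm_num, by norm_num⟩
  have h₃ := h ⟨3 / 4, by norm_num, by norm_num⟩
  -- A second difference with step 1/4 kills affine terms and sends `θ ^ 2` to 1/8, hence the factor
  -- 8.
  linear_combination 8 * (2 * h₂ - h₁ - h₃)

/-- A component whose law depends on `θ` has an event whose probabilities under `G 0` and `G 1`
differ. -/
theorem exists_real_ne_of_map_ne {E F : Type*} [MeasurableSpace E] [MeasurableSpace F]
    {G : Kernel ℝ E} [IsMarkovKernel G] {f : E → F} (hf : Measurable f)
    {θ₁ θ₂ : Set.Ioo (0 : ℝ) 1}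
    (h : (bernoulliFamily θ₁ ⊗ₘ G).map (fun p => f p.2) ≠
      (bernoulliFamily θ₂ ⊗ₘ G).map (fun p => f p.2)) :
    ∃ s, MeasurableSet s ∧ (G 1).real (f ⁻¹' s) - (G 0).real (f ⁻¹' s) ≠ 0 := by
  contrapose! h
  have hfs : Measurable fun p : ℝ × E => f p.2 := hf.comp measurable_snd
  have hprob (θ) : IsProbabilityMeasure ((bernoulliFamily θ ⊗ₘ G).map fun p => f p.2) :=
    Measure.isProbabilityMeasure_map hfs.aemeasurable
  -- With all slopes zero, `θ` drops out of the mixture.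
  have hlaw (θ) {s : Set F} (hs : MeasurableSet s) :
      ((bernoulliFamily θ ⊗ₘ G).map fun p => f p.2).real s = (G 0).real (f ⁻¹' s) := by
    rw [map_measureReal_apply hfs hs]
    refine (real_bernoulliFamily_compProd_snd_preimage G θ (hf hs)).trans ?_
    linear_combination θ.1 * h s hs
  refine Measure.ext fun s hs => ?_
  rw [← measureReal_eq_measureReal_iff, hlaw θ₁ hs, hlaw θ₂ hs]

theorem corollary2 {K : ℕ} (hK : 2 ≤ K) {𝓧 : Fin K → Type*} [∀ k, MeasurableSpace (𝓧 k)]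
    (T : (∀ k, 𝓧 k) → ℝ) : ¬ IsThinnedBy bernoulliFamily T := by
  rintro ⟨G, hG, hindep, hdep, -⟩
  let i : Fin K := ⟨0, by omega⟩
  let j : Fin K := ⟨1, by omega⟩
  have hij : i ≠ j := by simp [i, j]
  obtain ⟨_, _, hi⟩ := hdep i
  obtain ⟨_, _, hj⟩ := hdep j
  obtain ⟨A, hA, hA'⟩ := exists_real_ne_of_map_ne (measurable_pi_apply i) hi
  obtain ⟨B, hB, hB'⟩ := exists_real_ne_of_map_ne (measurable_pi_apply j) hj
  have hA₀ := measurable_pi_apply i hA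
  have hB₀ := measurable_pi_apply j hB
  refine mul_ne_zero hA' hB' (mul_sub_eq_zero_of_mixture_mul
    (c₀ := (G 0).real ((fun x => x i) ⁻¹' A ∩ (fun x => x j) ⁻¹' B))
    (c₁ := (G 1).real ((fun x => x i) ⁻¹' A ∩ (fun x => x j) ⁻¹' B)) fun θ => ?_)
  rw [← real_bernoulliFamily_compProd_snd_preimage G θ hA₀,
    ← real_bernoulliFamily_compProd_snd_preimage G θ hB₀,
    ← real_bernoulliFamily_compProd_snd_preimage G θ (hA₀.inter hB₀),
    Measure.real, Measure.real, Measure.real, ← ENNReal.toReal_mul]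
  exact congrArg ENNReal.toReal
    (((hindep θ).indepFun hij).measure_inter_preimage_eq_mul A B hA hB)
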